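/- All lattices are finite. For a poset $P$ write $x\prec y$ if $y$ covers $x$. The nullity of $P$ is $p-q+c$, where $p,q,c$ are the numbers of edges, vertices and connected components of its cover graph. $\mathrm{Irr}(P)$ is the set of elements with at most one lower and at most one upper cover, $\mathrm{Red}(P)$ its complement, and $\mathrm{Irr}^*(P)$ the set of elements with exactly one lower and exactly one upper cover. An element $x\in\mathrm{Irr}(P)$ is retractible if either there are no $y,z\in\mathrm{Red}(P)$ with $y\prec x\prec z$, or there are such $y,z$ and there is no other directed path from $y$ to $z$ in the cover graph (edges directed upwards). $P$ is a basic retract if no element of $\mathrm{Irr}^*(P)$ is retractible. The basic block associated to $P$ is obtained from $P$ by successively removing retractible elements of $\mathrm{Irr}^*$ until a basic retract is reached, and then successively removing all pendant vertices of the cover graph. An element $a$ of a lattice is meet-reducible (join-reducible) if $a=b\wedge c$ (respectively $a=b\vee c$) for some $b,c\neq a$, and reducible if it is one or the other. A block is a lattice whose largest element is join-reducible and whose smallest element is meet-reducible. Let $\mathscr{B}(j;4,3)$ be the set of isomorphism classes of blocks on $j$ elements that have exactly four reducible elements, these being pairwise comparable, and have nullity $3$. Let $\mathscr{B}(j;4,3,h)$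 be the subset of those whose associated basic block has height $h$ (length of a longest chain). For a chain $0\prec 1\prec\dots\prec m-1$ and pairs $(a_i,b_i)$ with $a_i+1<b_i$ ($i=1,2,3$), let $A_m(a_1b_1,a_2b_2,a_3b_3)$ be the poset obtained by adding three new elements $c_1,c_2,c_3$, where, for $x$ in the chain, $x\le c_i$ iff $x\le a_i$, $c_i\le x$ iff $b_i\le x$, and $c_i\le c_k$ iff $i=k$ or $b_i\le a_k$. Put $B_1=A_4(13,02,02)$, $B_2=A_4(02,13,13)$, $B_3=A_4(02,13,03)$, $B_4=A_5(13,13,04)$, $B_5=A_5(13,04,04)$, $B_6=A_5(14,24,02)$, $B_7=A_5(03,02,24)$, $B_8=A_5(14,24,04)$, $B_9=A_5(03,02,04)$, $B_{10}=A_5(13,04,03)$, $B_{11}=A_5(13,04,14)$, $B_{12}=A_5(14,03,13)$, $B_{13}=A_6(02,02,35)$, $B_{14}=A_6(35,35,02)$, $B_{15}=A_6(02,24,25)$, $B_{16}=A_6(35,13,03)$, $B_{17}=A_6(35,02,03)$, $B_{18}=A_6(02,35,25)$, $B_{19}=A_6(02,24,05)$, $B_{20}=A_6(35,13,05)$, $B_{21}=A_6(02,35,05)$,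 $B_{22}=A_7(02,24,46)$. Let $\mathbb{B}_i(j;4,3)$ be the subset of $\mathscr{B}(j;4,3)$ of those classes whose associated basic block is isomorphic to $B_i$. Theorem. For every integer $j\ge 7$, $$|\mathscr{B}(j;4,3)|=\sum_{h=3}^{6}|\mathscr{B}(j;4,3,h)|=\sum_{i=1}^{22}|\mathbb{B}_i(j;4,3)|.$$ -/

import Mathlib

/-! ### Finite posets: covers, nullity, irreducible elements -/

/-- The nullity of a poset: (edges) - (vertices) + (connected components) of its cover graph. -/
noncomputable def nullity (P : Type*) [PartialOrder P] : ℤ :=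
  ((SimpleGraph.hasse P).edgeSet.ncard : ℤ) - (Nat.card P : ℤ)
    + (Nat.card (SimpleGraph.hasse P).ConnectedComponent : ℤ)

/-- `x ∈ Irr(P)`: at most one lower cover and at most one upper cover. -/
def IsIrr {P : Type*} [PartialOrder P] (x : P) : Prop :=
  {y : P | y ⋖ x}.Subsingleton ∧ {z : P | x ⋖ z}.Subsingleton

/-- `x ∈ Irr*(P)`: exactly one lower cover and exactly one upper cover. -/
def IsIrrStar {P : Type*} [PartialOrder P] (x : P) : Prop :=
  (∃! y : P, y ⋖ x) ∧ (∃! z : P, x ⋖ z)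

/-- `l` lists the vertices of a directed path from `y` to `z` in the cover graph, every edge being
directed from the smaller to the larger element. -/
def IsDirectedPath {P : Type*} [PartialOrder P] (y z : P) (l : List P) : Prop :=
  l.IsChain (· ⋖ ·) ∧ l.head? = some y ∧ l.getLast? = some z

/-- Retractible elements: `x ∈ Irr(P)` and either there are no `y, z ∈ Red(P)` with `y ≺ x ≺ z`,
or there are such `y, z` and `y ≺ x ≺ z` is the only directed path from `y` to `z`. -/
def Retractible {P : Type*} [PartialOrder P] (x : P) : Prop :=
  IsIrr x ∧
    ((¬ ∃ y z : P, ¬ IsIrr y ∧ ¬ IsIrr z ∧ y ⋖ x ∧ x ⋖ z) ∨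
      (∃ y z : P, ¬ IsIrr y ∧ ¬ IsIrr z ∧ y ⋖ x ∧ x ⋖ z ∧
        ∀ l : List P, IsDirectedPath y z l → l = [y, x, z]))

/-- A poset is a basic retract if no element of `Irr*(P)` is retractible. -/
def IsBasicRetract (P : Type*) [PartialOrder P] : Prop :=
  ∀ x : P, IsIrrStar x → ¬ Retractible x

/-- A pendant vertex: a vertex of degree one in the cover graph. -/
def IsPendant {P : Type*} [PartialOrder P] (x : P) : Prop :=
  ∃! y : P, (SimpleGraph.hasse P).Adj x y

/-- `T` arises from the subposet `S` by removing one retractible element of `Irr*(S)`. -/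
def RetractStep {P : Type*} [PartialOrder P] (S T : Set P) : Prop :=
  ∃ x : S, IsIrrStar x ∧ Retractible x ∧ T = S \ {(x : P)}

/-- `T` arises from the subposet `S` by removing one pendant vertex. -/
def PendantStep {P : Type*} [PartialOrder P] (S T : Set P) : Prop :=
  ∃ x : S, IsPendant x ∧ T = S \ {(x : P)}

/-- `R` is a basic retract associated to `P`: a basic retract reached from `P` by successive
removal of retractible elements of `Irr*`. -/
def IsAssociatedBasicRetract {P : Type*} [PartialOrder P] (R : Set P) : Prop :=
  Relation.ReflTransGen RetractStep Set.univ R ∧ IsBasicRetract R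

/-- `S` is a basic block associated to `P`: obtained from a basic retract associated to `P` by
successive removal of pendant vertices until none is left. -/
def IsAssociatedBasicBlock {P : Type*} [PartialOrder P] (S : Set P) : Prop :=
  ∃ R : Set P, IsAssociatedBasicRetract R ∧ Relation.ReflTransGen PendantStep R S ∧
    ∀ x : S, ¬ IsPendant x

/-! ### Lattices: reducible elements and blocks -/

def MeetReducible {L : Type*} [Lattice L] (a : L) : Prop :=
  ∃ b c : L, b ≠ a ∧ c ≠ a ∧ b ⊓ c = a

def JoinReducible {L : Type*} [Lattice L] (a : L) : Prop :=
  ∃ b c : L, b ≠ a ∧ c ≠ a ∧ b ⊔ c = a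

def Reducible {L : Type*} [Lattice L] (a : L) : Prop :=
  MeetReducible a ∨ JoinReducible a

/-- A block: the largest element is join-reducible and the smallest one is meet-reducible. -/
def IsBlock (L : Type*) [Lattice L] : Prop :=
  (∃ t : L, IsTop t ∧ JoinReducible t) ∧ (∃ s : L, IsBot s ∧ MeetReducible s)

/-- `L` is a block with exactly `r` reducible elements, pairwise comparable, and nullity `k`. -/
def IsBlockWith (L : Type*) [Lattice L] (r k : ℕ) : Prop :=
  IsBlock L ∧ {a : L | Reducible a}.encard = (r : ℕ∞) ∧
    IsChain (· ≤ ·) {a : L | Reducible a} ∧ nullity L = (k : ℤ)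

/-- The basic block associated to `L` has height `h` (the length of a longest chain). -/
def BasicBlockHasHeight (L : Type*) [Lattice L] (h : ℕ) : Prop :=
  ∃ S : Set L, IsAssociatedBasicBlock S ∧ Order.krullDim S = (h : WithBot ℕ∞)

/-- The basic block associated to `L` is isomorphic to `B`. -/
def BasicBlockHasType (L : Type*) [Lattice L] (B : Type*) [PartialOrder B] : Prop :=
  ∃ S : Set L, IsAssociatedBasicBlock S ∧ Nonempty (S ≃o B)

/-! ### Isomorphism classes -/

/-- Isomorphism of lattice structures on the `n`-element set `Fin n` (the usual order of `Fin n`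
plays no role). -/
def latticeSetoid (n : ℕ) : Setoid (Lattice (Fin n)) where
  r A B := Nonempty (@OrderIso (Fin n) (Fin n) A.toLE B.toLE)
  iseqv :=
    { refl := fun A => ⟨@OrderIso.refl (Fin n) A.toLE⟩
      symm := fun {A B} ⟨e⟩ => ⟨@OrderIso.symm (Fin n) (Fin n) A.toLE B.toLE e⟩
      trans := fun {A B C} ⟨e⟩ ⟨f⟩ =>
        ⟨@OrderIso.trans (Fin n) (Fin n) (Fin n) A.toLE B.toLE C.toLE e f⟩ }

/-- Isomorphism classes of lattices on `n` elements. -/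
def LatticeClass (n : ℕ) : Type := Quotient (latticeSetoid n)

instance finite_latticeClass (n : ℕ) : Finite (LatticeClass n) := by
  have : Finite (Lattice (Fin n)) :=
    Finite.of_injective
      (fun (A : Lattice (Fin n)) (x y : Fin n) => A.toLE.le x y)
      (fun A B h => Lattice.ext fun {x y} => iff_of_eq (congrFun (congrFun h x) y))
  exact Quotient.finite _

/-- The isomorphism classes of the lattices on `n` elements that have the property `p`. -/
def classesOf (n : ℕ) (p : Lattice (Fin n) → Prop) : Set (LatticeClass n) :=
  {c | ∃ A : Lattice (Fin n), Quotient.mk (latticeSetoid n) A = c ∧ p A}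

/-- `𝓑(j; r, k)`. -/
def blockClasses (j r k : ℕ) : Set (LatticeClass j) :=
  classesOf j fun A => @IsBlockWith (Fin j) A r k

/-- `𝓑(j; r, k, h)`: the basic block associated to the block has height `h`. -/
def blockClassesOfHeight (j r k h : ℕ) : Set (LatticeClass j) :=
  classesOf j fun A => @IsBlockWith (Fin j) A r k ∧ @BasicBlockHasHeight (Fin j) A h

/-- The classes of `𝓑(j; r, k)` whose associated basic block is isomorphic to `B`. -/
def blockClassesOfType (j r k : ℕ) (B : Type) [PartialOrder B] : Set (LatticeClass j) :=
  classesOf j fun A => @IsBlockWith (Fin j) A r k ∧ @BasicBlockHasType (Fin j) A B _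

/-! ### The twenty-two basic blocks -/

/-- Data of an adjunct `C ]_{a₀}^{b₀} {c₀} ]_{a₁}^{b₁} {c₁} ]_{a₂}^{b₂} {c₂}` of the chain
`C : 0 ≺ 1 ≺ ⋯ ≺ len - 1` with three one-element lattices, all adjunct pairs lying in `C`. -/
structure AdjunctData where
  len : ℕ
  lo : Fin 3 → Fin len
  hi : Fin 3 → Fin len
  /-- `aᵢ < bᵢ`, and `aᵢ` is not covered by `bᵢ` in `C` -/
  gap : ∀ i, (lo i : ℕ) + 1 < hi i

/-- The underlying set: the chain and the three additional elements. -/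
inductive AdjunctData.Elem (D : AdjunctData) : Type
  | chain (x : Fin D.len) : D.Elem
  | extra (i : Fin 3) : D.Elem

/-- The order of the iterated adjunct. -/
def AdjunctData.Elem.le {D : AdjunctData} : D.Elem → D.Elem → Prop
  | .chain x, .chain y => x ≤ y
  | .chain x, .extra i => x ≤ D.lo i
  | .extra i, .chain y => D.hi i ≤ y
  | .extra i, .extra k => i = k ∨ D.hi i ≤ D.lo k

instance AdjunctData.Elem.instPartialOrder (D : AdjunctData) : PartialOrder D.Elem where
  le := AdjunctData.Elem.le
  le_refl x := by cases x <;> simp [AdjunctData.Elem.le]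
  le_trans x y z hxy hyz := by
    have h := D.gap
    cases x <;> cases y <;> cases z <;>
      simp only [AdjunctData.Elem.le, Fin.le_def] at * <;> grind
  le_antisymm x y hxy hyx := by
    have h := D.gap
    cases x <;> cases y <;>
      simp only [AdjunctData.Elem.le, Fin.le_def, AdjunctData.Elem.chain.injEq,
        AdjunctData.Elem.extra.injEq, reduceCtorEq, Fin.ext_iff] at * <;> grind

/-- `B₁, …, B₂₂` (entry `i` of the list is `B_{i+1}`). -/
def basicBlock : Fin 22 → AdjunctData :=
  ![⟨4, ![1, 0, 0], ![3, 2, 2], by decide⟩,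
    ⟨4, ![0, 1, 1], ![2, 3, 3], by decide⟩,
    ⟨4, ![0, 1, 0], ![2, 3, 3], by decide⟩,
    ⟨5, ![1, 1, 0], ![3, 3, 4], by decide⟩,
    ⟨5, ![1, 0, 0], ![3, 4, 4], by decide⟩,
    ⟨5, ![1, 2, 0], ![4, 4, 2], by decide⟩,
    ⟨5, ![0, 0, 2], ![3, 2, 4], by decide⟩,
    ⟨5, ![1, 2, 0], ![4, 4, 4], by decide⟩,
    ⟨5, ![0, 0, 0], ![3, 2, 4], by decide⟩,
    ⟨5, ![1, 0, 0], ![3, 4, 3], by decide⟩,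
    ⟨5, ![1, 0, 1], ![3, 4, 4], by decide⟩,
    ⟨5, ![1, 0, 1], ![4, 3, 3], by decide⟩,
    ⟨6, ![0, 0, 3], ![2, 2, 5], by decide⟩,
    ⟨6, ![3, 3, 0], ![5, 5, 2], by decide⟩,
    ⟨6, ![0, 2, 2], ![2, 4, 5], by decide⟩,
    ⟨6, ![3, 1, 0], ![5, 3, 3], by decide⟩,
    ⟨6, ![3, 0, 0], ![5, 2, 3], by decide⟩,
    ⟨6, ![0, 3, 2], ![2, 5, 5], by decide⟩,
    ⟨6, ![0, 2, 0], ![2, 4, 5], by decide⟩,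
    ⟨6, ![3, 1, 0], ![5, 3, 5], by decide⟩,
    ⟨6, ![0, 3, 0], ![2, 5, 5], by decide⟩,
    ⟨7, ![0, 2, 4], ![2, 4, 6], by decide⟩]


/-! ### Covers inside a subposet -/

section Subposet

variable {P : Type*} [PartialOrder P]

/-- `v` covers `u` in the subposet `S`. -/
def CovIn (S : Set P) (u v : P) : Prop :=
  u ∈ S ∧ v ∈ S ∧ u < v ∧ ∀ w ∈ S, u < w → ¬ w < v

/-- The elements of the subposet `S` with several upper or several lower covers in `S`. -/
def redIn (S : Set P) : Set P :=
  {x | x ∈ S ∧ ¬ ({u | CovIn S u x}.Subsingleton ∧ {v | CovIn S x v}.Subsingleton)}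

/-- The upper covers of `r` in `S` above which `s` is the least reducible element of `S`: they
represent the maximal paths from `r` to `s` through irreducible elements. -/
def edgesIn (S : Set P) (r s : P) : Set P :=
  {v | CovIn S r v ∧ IsLeast {t | t ∈ redIn S ∧ v ≤ t} s}

theorem covBy_iff_covIn {S : Set P} (u v : S) : u ⋖ v ↔ CovIn S (u : P) v := by
  constructor
  · intro h
    exact ⟨u.2, v.2, h.1, fun w hw h1 h2 => h.2 (c := ⟨w, hw⟩) h1 h2⟩
  · rintro ⟨-, -, h1, h2⟩
    exact ⟨h1, fun w hw1 hw2 => h2 w w.2 hw1 hw2⟩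

theorem isIrr_iff_notMem_redIn {S : Set P} (x : S) : IsIrr x ↔ (x : P) ∉ redIn S := by
  have hd : {y : S | y ⋖ x}.Subsingleton ↔ {u | CovIn S u (x : P)}.Subsingleton := by
    constructor
    · intro h u hu v hv
      exact congrArg Subtype.val (h (x := ⟨u, hu.1⟩) ((covBy_iff_covIn ⟨u, hu.1⟩ x).2 hu)
        (y := ⟨v, hv.1⟩) ((covBy_iff_covIn ⟨v, hv.1⟩ x).2 hv))
    · intro h u hu v hv
      exact Subtype.ext (h ((covBy_iff_covIn _ _).1 hu) ((covBy_iff_covIn _ _).1 hv))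
  have hu : {y : S | x ⋖ y}.Subsingleton ↔ {u | CovIn S (x : P) u}.Subsingleton := by
    constructor
    · intro h u hu v hv
      exact congrArg Subtype.val (h (x := ⟨u, hu.2.1⟩)
        ((covBy_iff_covIn x ⟨u, hu.2.1⟩).2 hu) (y := ⟨v, hv.2.1⟩)
        ((covBy_iff_covIn x ⟨v, hv.2.1⟩).2 hv))
    · intro h u hu v hv
      exact Subtype.ext (h ((covBy_iff_covIn _ _).1 hu) ((covBy_iff_covIn _ _).1 hv))
  rw [IsIrr, hd, hu, redIn]
  simp

theorem exists_covIn_le [Finite P] {S : Set P} {u v : P} (hu : u ∈ S) (hv : v ∈ S) (h : u < v) :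
    ∃ w, CovIn S u w ∧ w ≤ v := by
  obtain ⟨w, hw, hwv⟩ := exists_covBy_le_of_lt (show (⟨u, hu⟩ : S) < ⟨v, hv⟩ from h)
  exact ⟨w, (covBy_iff_covIn _ _).1 hw, hwv⟩

theorem exists_le_covIn [Finite P] {S : Set P} {u v : P} (hu : u ∈ S) (hv : v ∈ S) (h : u < v) :
    ∃ w, u ≤ w ∧ CovIn S w v := by
  obtain ⟨w, hwu, hw⟩ := exists_le_covBy_of_lt (show (⟨u, hu⟩ : S) < ⟨v, hv⟩ from h)
  exact ⟨w, hwu, (covBy_iff_covIn _ _).1 hw⟩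

theorem exists_isDirectedPath [Finite P] (v : P) : ∀ u : P, u ≤ v → ∃ l, IsDirectedPath u v l := by
  intro u
  induction u using (wellFounded_gt (α := P)).induction with
  | _ u ih =>
    intro huv
    rcases huv.eq_or_lt with rfl | huv
    · exact ⟨[u], by simp [IsDirectedPath]⟩
    · obtain ⟨w, huw, hwv⟩ := exists_covBy_le_of_lt huv
      obtain ⟨l, hl, hh, ht⟩ := ih w huw.1 hwv
      cases l with
      | nil => simp at hh
      | cons a l =>
        obtain rfl : a = w := by simpa using hh
        exact ⟨u :: a :: l, List.isChain_cons_cons.2 ⟨huw, hl⟩, rfl, by simpa using ht⟩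

/-- `y ≺ x ≺ z` are the only covers of `S` at `x`, and `x` is the only element of `S` between
`y` and `z`. -/
structure IsSqueezed (S : Set P) (y x z : P) : Prop where
  lower : CovIn S y x
  upper : CovIn S x z
  lower_unique : ∀ u, CovIn S u x → u = y
  upper_unique : ∀ v, CovIn S x v → v = z
  between : ∀ w ∈ S, y < w → w < z → w = x

theorem RetractStep.exists_isSqueezed [Finite P] {S T : Set P} (h : RetractStep S T) :
    ∃ y x z, IsSqueezed S y x z ∧ T = S \ {x} := by
  obtain ⟨x, ⟨⟨y, hyx, hy⟩, z, hxz, hz⟩, ⟨-, hx⟩, rfl⟩ := h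
  simp only at hyx hy hxz hz
  refine ⟨y, x, z, ⟨(covBy_iff_covIn _ _).1 hyx, (covBy_iff_covIn _ _).1 hxz, ?_, ?_, ?_⟩, rfl⟩
  · intro u hu
    exact congrArg Subtype.val (hy ⟨u, hu.1⟩ ((covBy_iff_covIn _ _).2 hu))
  · intro u hu
    exact congrArg Subtype.val (hz ⟨u, hu.2.1⟩ ((covBy_iff_covIn _ _).2 hu))
  · intro w hw h1 h2
    lift w to S using hw
    have h1 : y < w := h1
    have h2 : w < z := h2
    by_contra hne
    have hne : w ≠ x := fun h => hne (congrArg Subtype.val h)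
    have key1 : ¬ x ≤ w := fun h => hxz.2 (lt_of_le_of_ne h hne.symm) h2
    have key2 : ¬ w ≤ x := fun h => hyx.2 h1 (lt_of_le_of_ne h hne)
    obtain ⟨w', hw', hw'w⟩ := exists_covBy_le_of_lt h1
    obtain ⟨w'', hw''w, hw''⟩ := exists_le_covBy_of_lt h2
    rcases hx with hx | ⟨y', z', -, -, hy', hz', hl⟩
    · apply hx
      refine ⟨y, z, fun hi => ?_, fun hi => ?_, hyx, hxz⟩
      · exact key1 ((hi.2 hyx hw').le.trans hw'w)
      · exact key2 (hw''w.trans (hi.1 hw'' hxz).le)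
    · obtain rfl := hy y' hy'
      obtain rfl := hz z' hz'
      obtain ⟨l, hlc, hh, ht⟩ := exists_isDirectedPath z' w' (hw'w.trans h2.le)
      cases l with
      | nil => simp at hh
      | cons a l =>
        obtain rfl : a = w' := by simpa using hh
        have := hl (y' :: a :: l) ⟨List.isChain_cons_cons.2 ⟨hw', hlc⟩, rfl, by simpa using ht⟩
        simp only [List.cons.injEq, true_and] at this
        exact key1 (this.1 ▸ hw'w)

namespace IsSqueezed

variable {S : Set P} {x y z : P}

theorem covIn_diff_iff [Finite P] (h : IsSqueezed S y x z) {u v : P} :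
    CovIn (S \ {x}) u v ↔ (CovIn S u v ∧ u ≠ x ∧ v ≠ x) ∨ (u = y ∧ v = z) := by
  constructor
  · rintro ⟨⟨hu, hux⟩, ⟨hv, hvx⟩, huv, hw⟩
    have hux : u ≠ x := hux
    have hvx : v ≠ x := hvx
    by_cases hb : u < x ∧ x < v
    · right
      obtain ⟨y', huy, hy'⟩ := exists_le_covIn hu h.lower.2.1 hb.1
      obtain ⟨z', hz', hzv⟩ := exists_covIn_le h.lower.2.1 hv hb.2
      obtain rfl := h.lower_unique _ hy'
      obtain rfl := h.upper_unique _ hz'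
      have hyx := h.lower.2.2.1
      have hxz := h.upper.2.2.1
      constructor
      · by_contra hne
        exact hw y' ⟨h.lower.1, hyx.ne⟩ (lt_of_le_of_ne huy hne) (hyx.trans hb.2)
      · by_contra hne
        exact hw z' ⟨h.upper.2.1, hxz.ne'⟩ (hb.1.trans hxz) (lt_of_le_of_ne hzv (Ne.symm hne))
    · left
      refine ⟨⟨hu, hv, huv, fun w hwS h1 h2 => ?_⟩, hux, hvx⟩
      by_cases hwx : w = x
      · exact hb (hwx ▸ ⟨h1, h2⟩)
      · exact hw w ⟨hwS, hwx⟩ h1 h2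
  · rintro (⟨⟨hu, hv, huv, hw⟩, hux, hvx⟩ | ⟨rfl, rfl⟩)
    · exact ⟨⟨hu, hux⟩, ⟨hv, hvx⟩, huv, fun w hwS => hw w hwS.1⟩
    · refine ⟨⟨h.lower.1, h.lower.2.2.1.ne⟩, ⟨h.upper.2.1, h.upper.2.2.1.ne'⟩,
        h.lower.2.2.1.trans h.upper.2.2.1, fun w hwS h1 h2 => hwS.2 (h.between w hwS.1 h1 h2)⟩

theorem not_covIn (h : IsSqueezed S y x z) : ¬ CovIn S y z := fun hc =>
  hc.2.2.2 x h.lower.2.1 h.lower.2.2.1 h.upper.2.2.1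

open Classical in
theorem upper_diff [Finite P] (h : IsSqueezed S y x z) {u : P} (hu : u ≠ x) :
    {v | CovIn (S \ {x}) u v} = (fun v => if v = x then z else v) '' {v | CovIn S u v} := by
  ext v
  simp only [Set.mem_ofPred_eq, h.covIn_diff_iff, Set.mem_image]
  constructor
  · rintro (⟨hc, -, hv⟩ | ⟨rfl, rfl⟩)
    · exact ⟨v, hc, if_neg hv⟩
    · exact ⟨x, h.lower, if_pos rfl⟩
  · rintro ⟨w, hw, rfl⟩
    by_cases hwx : w = x
    · subst hwx
      exact Or.inr ⟨h.lower_unique _ hw, if_pos rfl⟩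
    · exact Or.inl (by simp [hwx, hw, hu])

open Classical in
theorem injOn_upper (h : IsSqueezed S y x z) {u : P} :
    Set.InjOn (fun v => if v = x then z else v) {v | CovIn S u v} := by
  have key : ∀ w, CovIn S u x → CovIn S u w → w ≠ z := fun w h1 h2 hwz => by
    rw [h.lower_unique _ h1, hwz] at h2
    exact h.not_covIn h2
  intro v hv w hw hvw
  simp only at hvw
  split_ifs at hvw with h1 h2 h2
  · rw [h1, h2]
  · exact absurd hvw.symm (key w (h1 ▸ hv) hw)
  · exact absurd hvw (key v (h2 ▸ hw) hv)
  · exact hvw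

open Classical in
theorem lower_diff [Finite P] (h : IsSqueezed S y x z) {u : P} (hu : u ≠ x) :
    {v | CovIn (S \ {x}) v u} = (fun v => if v = x then y else v) '' {v | CovIn S v u} := by
  ext v
  simp only [Set.mem_ofPred_eq, h.covIn_diff_iff, Set.mem_image]
  constructor
  · rintro (⟨hc, hv, -⟩ | ⟨rfl, rfl⟩)
    · exact ⟨v, hc, if_neg hv⟩
    · exact ⟨x, h.upper, if_pos rfl⟩
  · rintro ⟨w, hw, rfl⟩
    by_cases hwx : w = x
    · subst hwx
      exact Or.inr ⟨if_pos rfl, h.upper_unique _ hw⟩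
    · exact Or.inl (by simp [hwx, hw, hu])

open Classical in
theorem injOn_lower (h : IsSqueezed S y x z) {u : P} :
    Set.InjOn (fun v => if v = x then y else v) {v | CovIn S v u} := by
  have key : ∀ w, CovIn S x u → CovIn S w u → w ≠ y := fun w h1 h2 hwz => by
    rw [h.upper_unique _ h1, hwz] at h2
    exact h.not_covIn h2
  intro v hv w hw hvw
  simp only at hvw
  split_ifs at hvw with h1 h2 h2
  · rw [h1, h2]
  · exact absurd hvw.symm (key w (h1 ▸ hv) hw)
  · exact absurd hvw (key v (h2 ▸ hw) hv)
  · exact hvw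

theorem notMem_redIn (h : IsSqueezed S y x z) : x ∉ redIn S := fun hx =>
  hx.2 ⟨fun _ hu _ hv => (h.lower_unique _ hu).trans (h.lower_unique _ hv).symm,
    fun _ hu _ hv => (h.upper_unique _ hu).trans (h.upper_unique _ hv).symm⟩

theorem redIn_diff [Finite P] (h : IsSqueezed S y x z) : redIn (S \ {x}) = redIn S := by
  ext p
  by_cases hp : p = x
  · subst hp
    exact iff_of_false (fun hx => hx.1.2 rfl) h.notMem_redIn
  · have h1 : {v | CovIn (S \ {x}) p v}.Subsingleton ↔ {v | CovIn S p v}.Subsingleton := by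
      rw [h.upper_diff hp]
      exact ⟨fun hs u hu v hv => h.injOn_upper hu hv (hs ⟨u, hu, rfl⟩ ⟨v, hv, rfl⟩),
        fun hs => hs.image _⟩
    have h2 : {v | CovIn (S \ {x}) v p}.Subsingleton ↔ {v | CovIn S v p}.Subsingleton := by
      rw [h.lower_diff hp]
      exact ⟨fun hs u hu v hv => h.injOn_lower hu hv (hs ⟨u, hu, rfl⟩ ⟨v, hv, rfl⟩),
        fun hs => hs.image _⟩
    simp only [redIn, Set.mem_ofPred_eq, h1, h2, Set.mem_sdiff, Set.mem_singleton_iff, hp,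
      not_false_eq_true, and_true]

open Classical in
theorem ncard_edgesIn_diff [Finite P] (h : IsSqueezed S y x z) {r : P} (hr : r ∈ redIn S) (s : P) :
    (edgesIn (S \ {x}) r s).ncard = (edgesIn S r s).ncard := by
  have hrx : r ≠ x := fun hx => h.notMem_redIn (hx ▸ hr)
  have hset : {t | t ∈ redIn S ∧ x ≤ t} = {t | t ∈ redIn S ∧ z ≤ t} := by
    ext t
    refine and_congr_right fun ht => ⟨fun hxt => ?_, fun hzt => h.upper.2.2.1.le.trans hzt⟩
    have hne : x ≠ t := fun he => h.notMem_redIn (he ▸ ht)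
    obtain ⟨w, hw, hwt⟩ := exists_covIn_le h.lower.2.1 ht.1 (lt_of_le_of_ne hxt hne)
    exact h.upper_unique _ hw ▸ hwt
  have himg : edgesIn (S \ {x}) r s = (fun v => if v = x then z else v) '' edgesIn S r s := by
    have hup := h.upper_diff hrx
    ext v
    simp only [edgesIn, h.redIn_diff, Set.mem_ofPred_eq, Set.mem_image]
    rw [show CovIn (S \ {x}) r v ↔ _ from Set.ext_iff.1 hup v]
    constructor
    · rintro ⟨⟨w, hw, rfl⟩, hl⟩
      refine ⟨w, ⟨hw, ?_⟩, rfl⟩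
      by_cases hwx : w = x
      · rw [hwx, hset]; simpa [hwx] using hl
      · simpa [hwx] using hl
    · rintro ⟨w, ⟨hw, hl⟩, rfl⟩
      refine ⟨⟨w, hw, rfl⟩, ?_⟩
      by_cases hwx : w = x
      · rw [hwx, hset] at hl; simpa [hwx] using hl
      · simpa [hwx] using hl
  rw [himg, Set.InjOn.ncard_image (h.injOn_upper.mono fun v hv => hv.1)]

end IsSqueezed

theorem redIn_eq_of_retract [Finite P] {S T : Set P} (h : Relation.ReflTransGen RetractStep S T) :
    redIn T = redIn S := by
  induction h with
  | refl => rfl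
  | tail _ h ih =>
    obtain ⟨y, x, z, hs, rfl⟩ := h.exists_isSqueezed
    rw [hs.redIn_diff, ih]

theorem ncard_edgesIn_eq_of_retract [Finite P] {S T : Set P}
    (h : Relation.ReflTransGen RetractStep S T) {r : P} (hr : r ∈ redIn S) (s : P) :
    (edgesIn T r s).ncard = (edgesIn S r s).ncard := by
  induction h with
  | refl => rfl
  | tail h' h ih =>
    obtain ⟨y, x, z, hs, rfl⟩ := h.exists_isSqueezed
    rw [hs.ncard_edgesIn_diff (by rwa [redIn_eq_of_retract h']), ih]

theorem exists_isAssociatedBasicRetract (P : Type*) [PartialOrder P] [Finite P] :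
    ∃ R : Set P, IsAssociatedBasicRetract R := by
  obtain ⟨R, hR, hmin⟩ := Set.Finite.exists_minimalFor Set.ncard
    {R : Set P | Relation.ReflTransGen RetractStep Set.univ R} (Set.toFinite _) ⟨_, .refl⟩
  refine ⟨R, hR, fun x hx hret => ?_⟩
  have hlt : (R \ {(x : P)}).ncard < R.ncard := Set.ncard_sdiff_singleton_lt_of_mem x.2
  exact hlt.not_ge (hmin (hR.tail ⟨x, hx, hret, rfl⟩) hlt.le)

end Subposet

/-! ### Posets composed of a four-element chain and of elements hanging on it -/

/-- The elements outside the chain `r 0 < r 1 < r 2 < r 3` are determined by the largest `r (lo x)`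
below and the smallest `r (hi x)` above them, as is the order between them. -/
structure IsFrame {Q : Type*} [PartialOrder Q] (r : Fin 4 → Q) (lo hi : Q → Fin 4) : Prop where
  le_iff : ∀ a b, r a ≤ r b ↔ a ≤ b
  chain_le : ∀ a x, x ∉ Set.range r → (r a ≤ x ↔ a ≤ lo x)
  le_chain : ∀ a x, x ∉ Set.range r → (x ≤ r a ↔ hi x ≤ a)
  outer_le : ∀ x y, x ∉ Set.range r → y ∉ Set.range r → (x ≤ y ↔ x = y ∨ hi x ≤ lo y)

namespace IsFrame

variable {Q Q' : Type*} [PartialOrder Q] [PartialOrder Q'] {r : Fin 4 → Q} {r' : Fin 4 → Q'}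
  {lo hi : Q → Fin 4} {lo' hi' : Q' → Fin 4}

theorem injective (h : IsFrame r lo hi) : Function.Injective r := fun a b hab =>
  le_antisymm ((h.le_iff a b).1 hab.le) ((h.le_iff b a).1 hab.ge)

open Classical in
theorem exists_sumEquiv (h : IsFrame r lo hi) :
    ∃ e : Fin 4 ⊕ {x : Q // x ∉ Set.range r} ≃ Q,
      (∀ a, e (.inl a) = r a) ∧ ∀ x, e (.inr x) = x :=
  ⟨((Equiv.ofInjective r h.injective).sumCongr (Equiv.refl _)).trans
    (Equiv.sumCompl (· ∈ Set.range r)), fun _ => rfl, fun _ => rfl⟩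

/-- A poset with a frame is determined by the numbers of elements hanging at each place. -/
theorem nonempty_orderIso [Finite Q] [Finite Q'] (h : IsFrame r lo hi) (h' : IsFrame r' lo' hi')
    (hcard : ∀ a b, {x | x ∉ Set.range r ∧ lo x = a ∧ hi x = b}.ncard
      = {x | x ∉ Set.range r' ∧ lo' x = a ∧ hi' x = b}.ncard) :
    Nonempty (Q ≃o Q') := by
  let X := {x : Q // x ∉ Set.range r}
  let X' := {x : Q' // x ∉ Set.range r'}
  let f : X → Fin 4 × Fin 4 := fun x => (lo x, hi x)
  let f' : X' → Fin 4 × Fin 4 := fun x => (lo' x, hi' x)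
  have hfib : ∀ c, Nonempty ({x // f x = c} ≃ {x // f' x = c}) := by
    rintro ⟨a, b⟩
    have e1 : {x // f x = (a, b)} ≃ {x | x ∉ Set.range r ∧ lo x = a ∧ hi x = b} :=
      (Equiv.subtypeSubtypeEquivSubtypeInter _ (fun x : Q => (lo x, hi x) = (a, b))).trans
        (Equiv.subtypeEquivRight fun x => by simp)
    have e2 : {x // f' x = (a, b)} ≃ {x | x ∉ Set.range r' ∧ lo' x = a ∧ hi' x = b} :=
      (Equiv.subtypeSubtypeEquivSubtypeInter _ (fun x : Q' => (lo' x, hi' x) = (a, b))).trans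
        (Equiv.subtypeEquivRight fun x => by simp)
    obtain ⟨e⟩ := Finite.card_eq.1 (hcard a b)
    exact ⟨e1.trans (e.trans e2.symm)⟩
  let g : X ≃ X' := Equiv.ofFiberEquiv fun c => (hfib c).some
  have hg : ∀ x, f' (g x) = f x := Equiv.ofFiberEquiv_map _
  have hlo : ∀ x, lo' (g x) = lo x := fun x => congrArg Prod.fst (hg x)
  have hhi : ∀ x, hi' (g x) = hi x := fun x => congrArg Prod.snd (hg x)
  obtain ⟨e, hel, her⟩ := h.exists_sumEquiv
  obtain ⟨e', hel', her'⟩ := h'.exists_sumEquiv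
  have key : ∀ s t, e' (Sum.map id g s) ≤ e' (Sum.map id g t) ↔ e s ≤ e t := by
    rintro (a | x) (b | y)
    · simp only [Sum.map_inl, id, hel, hel', h.le_iff, h'.le_iff]
    · simp only [Sum.map_inl, Sum.map_inr, id, hel, hel', her, her', h.chain_le _ _ y.2,
        h'.chain_le _ _ (g y).2, hlo]
    · simp only [Sum.map_inl, Sum.map_inr, id, hel, hel', her, her', h.le_chain _ _ x.2,
        h'.le_chain _ _ (g x).2, hhi]
    · simp only [Sum.map_inr, her, her', h.outer_le _ _ x.2 y.2, h'.outer_le _ _ (g x).2 (g y).2,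
        hhi, hlo, Subtype.val_inj, g.injective.eq_iff]
  exact ⟨⟨e.symm.trans (((Equiv.refl _).sumCongr g).trans e'), fun {p q} => by
    simpa using key (e.symm p) (e.symm q)⟩⟩

end IsFrame

/-! ### The structure of basic retracts with four comparable reducible elements -/

section Structure

variable {P : Type*} [PartialOrder P]

/-- The reducible elements of the subposet `S` are `r 0 < r 1 < r 2 < r 3`, the first one being
the least and the last one being the largest element of `S`. -/
structure IsRedChain (S : Set P) (r : Fin 4 → P) : Prop where
  mono : StrictMono r
  range_eq : Set.range r = redIn S
  bot_le : ∀ x ∈ S, r 0 ≤ x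
  le_top : ∀ x ∈ S, x ≤ r 3

/-- The irreducible elements `x` of `S` with `u ≺ x ≺ v`. -/
def midIn (S : Set P) (u v : P) : Set P := {x | x ∉ redIn S ∧ CovIn S u x ∧ CovIn S x v}

theorem lower_unique_of_notMem_redIn {S : Set P} {x u v : P} (hx : x ∉ redIn S) (hu : CovIn S u x)
    (hv : CovIn S v x) : u = v := by
  by_contra hne
  exact hx ⟨hu.2.1, fun h => hne (h.1 hu hv)⟩

theorem upper_unique_of_notMem_redIn {S : Set P} {x u v : P} (hx : x ∉ redIn S) (hu : CovIn S x u)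
    (hv : CovIn S x v) : u = v := by
  by_contra hne
  exact hx ⟨hu.1, fun h => hne (h.2 hu hv)⟩

theorem upper_le_of_notMem_redIn [Finite P] {S : Set P} {x v w : P} (hx : x ∉ redIn S)
    (hv : CovIn S x v) (hw : w ∈ S) (h : x < w) : v ≤ w := by
  obtain ⟨v', hv', hle⟩ := exists_covIn_le hv.1 hw h
  exact upper_unique_of_notMem_redIn hx hv hv' ▸ hle

theorem le_lower_of_notMem_redIn [Finite P] {S : Set P} {x u w : P} (hx : x ∉ redIn S)
    (hu : CovIn S u x) (hw : w ∈ S) (h : w < x) : w ≤ u := by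
  obtain ⟨v', hle, hv'⟩ := exists_le_covIn hw hu.2.1 h
  exact lower_unique_of_notMem_redIn hx hu hv' ▸ hle

namespace IsRedChain

variable {S : Set P} {r : Fin 4 → P}

theorem le_iff (h : IsRedChain S r) {a b : Fin 4} : r a ≤ r b ↔ a ≤ b := h.mono.le_iff_le

theorem mem_redIn (h : IsRedChain S r) (a : Fin 4) : r a ∈ redIn S := h.range_eq ▸ ⟨a, rfl⟩

theorem mem (h : IsRedChain S r) (a : Fin 4) : r a ∈ S := (h.mem_redIn a).1

theorem of_retract [Finite P] (h : IsRedChain S r) {T : Set P}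
    (hT : Relation.ReflTransGen RetractStep S T) : IsRedChain T r := by
  have hsub : T ⊆ S := by
    induction hT with
    | refl => exact subset_rfl
    | tail _ hs ih =>
      obtain ⟨x, -, -, rfl⟩ := hs
      exact Set.sdiff_subset.trans ih
  exact ⟨h.mono, by rw [h.range_eq, redIn_eq_of_retract hT], fun x hx => h.bot_le x (hsub hx),
    fun x hx => h.le_top x (hsub hx)⟩

theorem exists_covIn_left [Finite P] (h : IsRedChain S r) {x : P} (hx : x ∈ S) (hr : x ∉ redIn S) :
    ∃ u, CovIn S u x := by
  have hne : r 0 ≠ x := fun he => hr (he ▸ h.mem_redIn 0)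
  obtain ⟨u, -, hu⟩ := exists_le_covIn (h.mem 0) hx (lt_of_le_of_ne (h.bot_le x hx) hne)
  exact ⟨u, hu⟩

theorem exists_covIn_right [Finite P] (h : IsRedChain S r) {x : P} (hx : x ∈ S) (hr : x ∉ redIn S) :
    ∃ u, CovIn S x u := by
  have hne : x ≠ r 3 := fun he => hr (he ▸ h.mem_redIn 3)
  obtain ⟨u, hu, -⟩ := exists_covIn_le hx (h.mem 3) (lt_of_le_of_ne (h.le_top x hx) hne)
  exact ⟨u, hu⟩

theorem isIrrStar [Finite P] (h : IsRedChain S r) (x : S) (hr : (x : P) ∉ redIn S) :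
    IsIrrStar x := by
  obtain ⟨u, hu⟩ := h.exists_covIn_left x.2 hr
  obtain ⟨v, hv⟩ := h.exists_covIn_right x.2 hr
  refine ⟨⟨⟨u, hu.1⟩, (covBy_iff_covIn _ _).2 hu, fun w hw => Subtype.ext ?_⟩,
    ⟨⟨v, hv.2.1⟩, (covBy_iff_covIn _ _).2 hv, fun w hw => Subtype.ext ?_⟩⟩
  · exact lower_unique_of_notMem_redIn hr ((covBy_iff_covIn _ _).1 hw) hu
  · exact upper_unique_of_notMem_redIn hr ((covBy_iff_covIn _ _).1 hw) hv

theorem not_isPendant [Finite P] (h : IsRedChain S r) (x : S) : ¬ IsPendant x := by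
  rintro ⟨y, -, hy⟩
  have hup : ∀ v, CovIn S (x : P) v → v = y := fun v hv =>
    congrArg Subtype.val (hy ⟨v, hv.2.1⟩
      (SimpleGraph.hasse_adj.2 (.inl ((covBy_iff_covIn _ _).2 hv))))
  have hdn : ∀ v, CovIn S v (x : P) → v = y := fun v hv =>
    congrArg Subtype.val (hy ⟨v, hv.1⟩
      (SimpleGraph.hasse_adj.2 (.inr ((covBy_iff_covIn _ _).2 hv))))
  by_cases hr : (x : P) ∈ redIn S
  · exact hr.2 ⟨fun u hu v hv => (hdn u hu).trans (hdn v hv).symm,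
      fun u hu v hv => (hup u hu).trans (hup v hv).symm⟩
  · obtain ⟨u, hu⟩ := h.exists_covIn_left x.2 hr
    obtain ⟨v, hv⟩ := h.exists_covIn_right x.2 hr
    exact (hu.2.2.1.trans hv.2.2.1).ne ((hdn u hu).trans (hup v hv).symm)

theorem exists_ends [Finite P] (h : IsRedChain S r) (hS : IsBasicRetract S) {x : P} (hx : x ∈ S)
    (hr : x ∉ redIn S) : ∃ a b, CovIn S (r a) x ∧ CovIn S x (r b) := by
  have hn := hS ⟨x, hx⟩ (h.isIrrStar ⟨x, hx⟩ hr)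
  by_contra! hc
  refine hn ⟨(isIrr_iff_notMem_redIn _).2 hr, .inl ?_⟩
  rintro ⟨y, z, hy, hz, hyx, hxz⟩
  rw [isIrr_iff_notMem_redIn, not_not, ← h.range_eq] at hy hz
  obtain ⟨a, ha⟩ := hy
  obtain ⟨b, hb⟩ := hz
  exact hc a b (ha ▸ (covBy_iff_covIn _ _).1 hyx) (hb ▸ (covBy_iff_covIn _ _).1 hxz)

theorem edgesIn_eq [Finite P] (h : IsRedChain S r) (hS : IsBasicRetract S) (a b : Fin 4) :
    edgesIn S (r a) (r b) = midIn S (r a) (r b) ∪ {v | v = r b ∧ CovIn S (r a) (r b)} := by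
  ext v
  constructor
  · rintro ⟨hc, ⟨-, hvb⟩, hl⟩
    by_cases hv : v ∈ redIn S
    · have : v = r b := le_antisymm hvb (hl ⟨hv, le_rfl⟩)
      exact .inr ⟨this, this ▸ hc⟩
    · obtain ⟨a', b', -, hb'⟩ := h.exists_ends hS hc.2.1 hv
      have h1 : r b ≤ r b' := hl ⟨h.mem_redIn b', hb'.2.2.1.le⟩
      have h2 : r b' ≤ r b := upper_le_of_notMem_redIn hv hb' (h.mem b)
        (lt_of_le_of_ne hvb fun he => hv (he ▸ h.mem_redIn b))
      exact .inl ⟨hv, hc, le_antisymm h1 h2 ▸ hb'⟩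
  · rintro (⟨hv, hc, hb⟩ | ⟨rfl, hc⟩)
    · refine ⟨hc, ⟨h.mem_redIn b, hb.2.2.1.le⟩, fun t ht => ?_⟩
      exact upper_le_of_notMem_redIn hv hb ht.1.1 (lt_of_le_of_ne ht.2 fun he => hv (he ▸ ht.1))
    · exact ⟨hc, ⟨h.mem_redIn b, le_rfl⟩, fun t ht => ht.2⟩

theorem midIn_eq_empty {a b : Fin 4} (hc : CovIn S (r a) (r b)) : midIn S (r a) (r b) = ∅ := by
  ext x
  simp only [midIn, Set.mem_ofPred_eq, Set.mem_empty_iff_false, iff_false]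
  rintro ⟨-, h1, h2⟩
  exact hc.2.2.2 x h1.2.1 h1.2.2.1 h2.2.2.1

theorem retractible_of_midIn_eq_singleton [Finite P] (h : IsRedChain S r) {a b : Fin 4}
    (hab : (a : ℕ) + 1 = b) (hS : IsBasicRetract S) {x : P} (hx : x ∈ S)
    (hm : midIn S (r a) (r b) = {x}) : Retractible (⟨x, hx⟩ : S) := by
  obtain ⟨hr, hax, hxb⟩ : x ∈ midIn S (r a) (r b) := hm ▸ rfl
  refine ⟨(isIrr_iff_notMem_redIn _).2 hr, .inr ⟨⟨r a, h.mem a⟩, ⟨r b, h.mem b⟩, ?_, ?_,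
    (covBy_iff_covIn _ _).2 hax, (covBy_iff_covIn _ _).2 hxb, ?_⟩⟩
  · rw [isIrr_iff_notMem_redIn, not_not]; exact h.mem_redIn a
  · rw [isIrr_iff_notMem_redIn, not_not]; exact h.mem_redIn b
  have hle : ∀ (l : List S) (u v : S), IsDirectedPath u v l → u ≤ v := by
    intro l
    induction l with
    | nil => rintro u v ⟨-, h, -⟩; simp at h
    | cons w l ih =>
      rintro u v ⟨hc, hh, ht⟩
      obtain rfl : w = u := by simpa using hh
      cases l with
      | nil =>
        have : w = v := by simpa using ht
        exact this.le
      | cons w' l =>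
        rw [List.isChain_cons_cons] at hc
        exact hc.1.le.trans (ih w' v ⟨hc.2, rfl, by simpa using ht⟩)
  rintro l ⟨hc, hh, ht⟩
  rcases l with _ | ⟨p, l⟩
  · simp at hh
  obtain rfl : p = ⟨r a, h.mem a⟩ := by simpa using hh
  rcases l with _ | ⟨q, l⟩
  · have : (⟨r a, h.mem a⟩ : S) = ⟨r b, h.mem b⟩ := by simpa using ht
    have := h.mono.injective (congrArg Subtype.val this)
    omega
  rw [List.isChain_cons_cons] at hc
  have hqb : q ≤ ⟨r b, h.mem b⟩ := hle _ _ _ ⟨hc.2, rfl, by simpa using ht⟩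
  have haq := (covBy_iff_covIn _ _).1 hc.1
  have hqr : (q : P) ∉ redIn S := by
    intro hq
    rw [← h.range_eq] at hq
    obtain ⟨c, hc⟩ := hq
    have h1 : a < c := h.mono.lt_iff_lt.1 (hc ▸ haq.2.2.1)
    have h2 : c ≤ b := h.le_iff.1 (hc ▸ hqb)
    obtain rfl : c = b := by omega
    exact haq.2.2.2 x hx hax.2.2.1 (hc ▸ hxb.2.2.1)
  obtain ⟨a', b', -, hb'⟩ := h.exists_ends hS q.2 hqr
  have hb'b : b' ≤ b := h.le_iff.1 (upper_le_of_notMem_redIn hqr hb' (h.mem b)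
    (lt_of_le_of_ne hqb fun he => hqr (by rw [he]; exact h.mem_redIn b)))
  have hab' : a < b' := h.mono.lt_iff_lt.1 (haq.2.2.1.trans hb'.2.2.1)
  obtain rfl : b' = b := by omega
  have hqx : (q : P) = x := by
    have : (q : P) ∈ midIn S (r a) (r b') := ⟨hqr, haq, hb'⟩
    rwa [hm] at this
  obtain rfl : q = ⟨x, hx⟩ := Subtype.ext hqx
  rcases l with _ | ⟨s, l⟩
  · have : (⟨x, hx⟩ : S) = ⟨r b', h.mem b'⟩ := by simpa using ht
    exact absurd (congrArg Subtype.val this) hb'.2.2.1.ne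
  have hc2 := (List.isChain_cons_cons.1 hc.2)
  obtain rfl : s = ⟨r b', h.mem b'⟩ :=
    Subtype.ext (upper_unique_of_notMem_redIn hr ((covBy_iff_covIn _ _).1 hc2.1) hxb)
  rcases l with _ | ⟨t, l⟩
  · rfl
  have hc3 := (List.isChain_cons_cons.1 hc2.2)
  exact absurd (hle _ _ _ ⟨hc3.2, rfl, by simpa using ht⟩) hc3.1.1.not_ge

/-- In a basic retract, the irreducible elements between `r a` and `r b` are counted by the
number of edges from `r a` to `r b`, except for a single edge between neighbours. -/
theorem ncard_midIn [Finite P] (h : IsRedChain S r) (hS : IsBasicRetract S) (a b : Fin 4) :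
    (midIn S (r a) (r b)).ncard =
      if (a : ℕ) + 1 = b ∧ (edgesIn S (r a) (r b)).ncard = 1 then 0
      else (edgesIn S (r a) (r b)).ncard := by
  have he := h.edgesIn_eq hS a b
  by_cases hc : CovIn S (r a) (r b)
  · have hab : (a : ℕ) + 1 = b := by
      have hlt : a < b := h.mono.lt_iff_lt.1 hc.2.2.1
      by_contra hne
      have hlt2 : (a : ℕ) + 1 < b := by omega
      refine hc.2.2.2 (r ⟨a + 1, by omega⟩) (h.mem _) (h.mono ?_) (h.mono ?_)
      · exact Fin.lt_def.2 (by simp)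
      · exact Fin.lt_def.2 (by simpa using hlt2)
    have h1 : edgesIn S (r a) (r b) = {r b} := by
      rw [he, midIn_eq_empty hc]; ext; simp [hc]
    rw [if_pos ⟨hab, by rw [h1, Set.ncard_singleton]⟩, midIn_eq_empty hc, Set.ncard_empty]
  · have h1 : edgesIn S (r a) (r b) = midIn S (r a) (r b) := by
      rw [he]; ext; simp [hc]
    rw [h1, if_neg]
    rintro ⟨hab, h2⟩
    obtain ⟨x, hx⟩ := Set.ncard_eq_one.1 h2
    have hxm : x ∈ midIn S (r a) (r b) := hx ▸ rfl
    exact hS ⟨x, hxm.2.1.2.1⟩ (h.isIrrStar _ hxm.1)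
      (h.retractible_of_midIn_eq_singleton hab hS hxm.2.1.2.1 hx)

theorem exists_isFrame [Finite P] (h : IsRedChain S r) (hS : IsBasicRetract S) :
    ∃ (r' : Fin 4 → S) (lo hi : S → Fin 4), IsFrame r' lo hi ∧
      ∀ a b, {x | x ∉ Set.range r' ∧ lo x = a ∧ hi x = b}.ncard = (midIn S (r a) (r b)).ncard := by
  have hex : ∀ x : S, ∃ a b, (x : P) ∉ redIn S → CovIn S (r a) x ∧ CovIn S (x : P) (r b) := by
    intro x
    by_cases hx : (x : P) ∈ redIn S
    · exact ⟨0, 0, fun h => absurd hx h⟩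
    · obtain ⟨a, b, hab⟩ := h.exists_ends hS x.2 hx
      exact ⟨a, b, fun _ => hab⟩
  choose lo hi hlh using hex
  let r' : Fin 4 → S := fun a => ⟨r a, h.mem a⟩
  have hr' : ∀ x : S, x ∉ Set.range r' ↔ (x : P) ∉ redIn S := by
    intro x
    rw [← h.range_eq, not_iff_not]
    exact ⟨fun ⟨a, ha⟩ => ⟨a, congrArg Subtype.val ha⟩, fun ⟨a, ha⟩ => ⟨a, Subtype.ext ha⟩⟩
  have hcl : ∀ a (x : S), (x : P) ∉ redIn S → (r a ≤ x ↔ a ≤ lo x) := fun a x hx =>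
    ⟨fun hle => h.le_iff.1 (le_lower_of_notMem_redIn hx (hlh x hx).1 (h.mem a)
      (lt_of_le_of_ne hle fun he => hx (he ▸ h.mem_redIn a))),
      fun hle => (h.le_iff.2 hle).trans (hlh x hx).1.2.2.1.le⟩
  have hlc : ∀ a (x : S), (x : P) ∉ redIn S → ((x : P) ≤ r a ↔ hi x ≤ a) := fun a x hx =>
    ⟨fun hle => h.le_iff.1 (upper_le_of_notMem_redIn hx (hlh x hx).2 (h.mem a)
      (lt_of_le_of_ne hle fun he => hx (he ▸ h.mem_redIn a))),
      fun hle => (hlh x hx).2.2.2.1.le.trans (h.le_iff.2 hle)⟩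
  refine ⟨r', lo, hi, ⟨fun a b => h.le_iff, fun a x hx => hcl a x ((hr' x).1 hx),
    fun a x hx => hlc a x ((hr' x).1 hx), fun x y hx hy => ?_⟩, fun a b => ?_⟩
  · rw [hr'] at hx hy
    constructor
    · intro hxy
      rcases hxy.eq_or_lt with he | hlt
      · exact .inl he
      · exact .inr ((hcl _ y hy).1 (upper_le_of_notMem_redIn hx (hlh x hx).2 y.2 hlt))
    · rintro (rfl | hle)
      · exact le_rfl
      · exact ((hlc _ x hx).2 hle).trans ((hcl _ y hy).2 le_rfl)
  · rw [← Set.ncard_image_of_injective _ Subtype.val_injective]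
    congr 1
    ext p
    constructor
    · rintro ⟨x, ⟨hx, rfl, rfl⟩, rfl⟩
      rw [hr'] at hx
      exact ⟨hx, (hlh x hx).1, (hlh x hx).2⟩
    · rintro ⟨hp, h1, h2⟩
      refine ⟨⟨p, h1.2.1⟩, ⟨(hr' _).2 hp, ?_, ?_⟩, rfl⟩
      · exact h.mono.injective (lower_unique_of_notMem_redIn hp (hlh ⟨p, h1.2.1⟩ hp).1 h1)
      · exact h.mono.injective (upper_unique_of_notMem_redIn hp (hlh ⟨p, h1.2.1⟩ hp).2 h2)

/-! ### Constraints on the numbers of edges -/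

theorem ncard_edgesIn_eq_zero (h : IsRedChain S r) {a b : Fin 4} (hba : b ≤ a) :
    (edgesIn S (r a) (r b)).ncard = 0 := by
  have : edgesIn S (r a) (r b) = ∅ := by
    rw [Set.eq_empty_iff_forall_notMem]
    rintro v ⟨hc, ⟨-, hv⟩, -⟩
    exact (h.mono.lt_iff_lt.1 (hc.2.2.1.trans_le hv)).not_ge hba
  rw [this, Set.ncard_empty]

theorem ncard_edgesIn_pos [Finite P] (h : IsRedChain S r) {a b : Fin 4} (hab : (a : ℕ) + 1 = b) :
    0 < (edgesIn S (r a) (r b)).ncard := by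
  rw [Set.ncard_pos]
  have hlt : a < b := by omega
  obtain ⟨v, hv, hvb⟩ := exists_covIn_le (h.mem a) (h.mem b) (h.mono hlt)
  refine ⟨v, hv, ⟨h.mem_redIn b, hvb⟩, ?_⟩
  rintro t ⟨ht, hvt⟩
  rw [← h.range_eq] at ht
  obtain ⟨c, rfl⟩ := ht
  have := h.mono.lt_iff_lt.1 (hv.2.2.1.trans_le hvt)
  exact h.le_iff.2 (by omega)

theorem ncard_upper_eq [Finite P] (h : IsRedChain S r) (a : Fin 4) :
    {v | CovIn S (r a) v}.ncard = ∑ b, (edgesIn S (r a) (r b)).ncard := by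
  classical
  have hU : {v | CovIn S (r a) v} = ⋃ b, edgesIn S (r a) (r b) := by
    ext v
    simp only [Set.mem_iUnion]
    refine ⟨fun hv => ?_, fun ⟨b, hb⟩ => hb.1⟩
    have hne : (Finset.univ.filter fun b => v ≤ r b).Nonempty :=
      ⟨3, by simpa using h.le_top v hv.2.1⟩
    refine ⟨_, hv, ⟨h.mem_redIn _, (Finset.mem_filter.1 (Finset.min'_mem _ hne)).2⟩, ?_⟩
    rintro t ⟨ht, hvt⟩
    rw [← h.range_eq] at ht
    obtain ⟨c, rfl⟩ := ht
    exact h.le_iff.2 (Finset.min'_le _ _ (by simpa using hvt))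
  have hd : Pairwise (Function.onFun Disjoint fun b => edgesIn S (r a) (r b)) := by
    intro b c hbc
    rw [Function.onFun, Set.disjoint_left]
    exact fun v hb hc => hbc (h.mono.injective (hb.2.unique hc.2))
  rw [hU, Set.ncard_iUnion_of_finite (fun _ => Set.toFinite _) hd, finsum_eq_sum_of_fintype]

theorem ncard_lower_le [Finite P] (h : IsRedChain S r) (hS : IsBasicRetract S) (b : Fin 4) :
    {u | CovIn S u (r b)}.ncard ≤ ∑ a, (edgesIn S (r a) (r b)).ncard := by
  have hD : {u | CovIn S u (r b)} ⊆
      ⋃ a, (midIn S (r a) (r b) ∪ {v | v = r a ∧ CovIn S (r a) (r b)}) := by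
    intro u hu
    rw [Set.mem_iUnion]
    by_cases hr : u ∈ redIn S
    · rw [← h.range_eq] at hr
      obtain ⟨a, rfl⟩ := hr
      exact ⟨a, .inr ⟨rfl, hu⟩⟩
    · obtain ⟨a, -, ha, -⟩ := h.exists_ends hS hu.1 hr
      exact ⟨a, .inl ⟨hr, ha, hu⟩⟩
  refine (Set.ncard_le_ncard hD (Set.toFinite _)).trans ?_
  have hle := Finset.set_ncard_biUnion_le Finset.univ
    fun a => midIn S (r a) (r b) ∪ {v | v = r a ∧ CovIn S (r a) (r b)}
  simp only [Finset.mem_univ, Set.iUnion_true] at hle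
  refine hle.trans (Finset.sum_le_sum fun a _ => ?_)
  rw [h.edgesIn_eq hS]
  by_cases hc : CovIn S (r a) (r b)
  · simp [midIn_eq_empty hc, hc]
  · simp [hc]

theorem two_le_of_basic [Finite P] (h : IsRedChain S r) (hS : IsBasicRetract S) (c : Fin 4) :
    2 ≤ ∑ b, (edgesIn S (r c) (r b)).ncard ∨ 2 ≤ ∑ a, (edgesIn S (r a) (r c)).ncard := by
  have hc := (h.mem_redIn c).2
  rw [not_and_or, Set.not_subsingleton_iff, Set.not_subsingleton_iff] at hc
  rcases hc with hc | hc
  · exact .inr (((Set.one_lt_ncard_iff_nontrivial).2 hc).trans_le (h.ncard_lower_le hS c))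
  · exact .inl (((Set.one_lt_ncard_iff_nontrivial).2 hc).trans_eq (h.ncard_upper_eq c))

end IsRedChain

end Structure

/-! ### Reducible elements and nullity of finite lattices -/

section Lattice

variable {L : Type*} [Lattice L]

theorem covIn_univ_iff {P : Type*} [PartialOrder P] {u v : P} : CovIn Set.univ u v ↔ u ⋖ v := by
  simp [CovIn, CovBy]

theorem inf_eq_of_covBy {a u v : L} (hu : a ⋖ u) (hv : a ⋖ v) (huv : u ≠ v) : u ⊓ v = a := by
  rcases (le_inf hu.le hv.le).eq_or_lt with h | h
  · exact h.symm
  · have h1 : u ⊓ v = u := (hu.eq_or_eq h.le inf_le_left).resolve_left h.ne'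
    have h2 : u ⊓ v = v := (hv.eq_or_eq h.le inf_le_right).resolve_left h.ne'
    exact absurd (h1.symm.trans h2) huv

theorem sup_eq_of_covBy {a u v : L} (hu : u ⋖ a) (hv : v ⋖ a) (huv : u ≠ v) : u ⊔ v = a :=
  inf_eq_of_covBy (L := Lᵒᵈ) hu.toDual hv.toDual huv

theorem meetReducible_iff [Finite L] (a : L) : MeetReducible a ↔ ¬ {v | a ⋖ v}.Subsingleton := by
  rw [Set.not_subsingleton_iff]
  constructor
  · rintro ⟨b, c, hb, hc, rfl⟩
    obtain ⟨u, hu, hub⟩ := exists_covBy_le_of_lt (lt_of_le_of_ne inf_le_left hb.symm)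
    obtain ⟨v, hv, hvc⟩ := exists_covBy_le_of_lt (lt_of_le_of_ne inf_le_right hc.symm)
    refine ⟨u, hu, v, hv, fun h => ?_⟩
    exact hu.1.not_ge (le_inf hub (h ▸ hvc))
  · rintro ⟨u, hu, v, hv, huv⟩
    exact ⟨u, v, hu.1.ne', hv.1.ne', inf_eq_of_covBy hu hv huv⟩

theorem joinReducible_iff [Finite L] (a : L) : JoinReducible a ↔ ¬ {u | u ⋖ a}.Subsingleton := by
  rw [Set.not_subsingleton_iff]
  constructor
  · rintro ⟨b, c, hb, hc, rfl⟩
    obtain ⟨u, hub, hu⟩ := exists_le_covBy_of_lt (lt_of_le_of_ne le_sup_left hb)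
    obtain ⟨v, hvc, hv⟩ := exists_le_covBy_of_lt (lt_of_le_of_ne le_sup_right hc)
    refine ⟨u, hu, v, hv, fun h => ?_⟩
    exact hu.1.not_ge (sup_le hub (h ▸ hvc))
  · rintro ⟨u, hu, v, hv, huv⟩
    exact ⟨u, v, hu.1.ne, hv.1.ne, sup_eq_of_covBy hu hv huv⟩

theorem redIn_univ_eq [Finite L] : redIn (Set.univ : Set L) = {a | Reducible a} := by
  ext a
  simp only [redIn, covIn_univ_iff, Set.mem_ofPred_eq, Set.mem_univ, true_and, Reducible,
    meetReducible_iff, joinReducible_iff]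
  tauto

theorem exists_isRedChain [Finite L] (h : IsBlock L) (hcard : {a : L | Reducible a}.encard = 4)
    (hchain : IsChain (· ≤ ·) {a : L | Reducible a}) :
    ∃ r, IsRedChain (Set.univ : Set L) r := by
  classical
  have := Fintype.ofFinite L
  let _ : LinearOrder {a : L | Reducible a} := hchain.linearOrder
  have hc : Fintype.card {a : L | Reducible a} = 4 := by
    rw [← Nat.card_eq_fintype_card, Nat.card_coe_set_eq, Set.ncard, hcard]; rfl
  let e := Fintype.orderIsoFinOfCardEq {a : L | Reducible a} hc
  obtain ⟨⟨t, ht, htr⟩, s, hs, hsr⟩ := h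
  refine ⟨fun a => e a, fun a b hab => e.strictMono hab, ?_, fun x _ => ?_, fun x _ => ?_⟩
  · rw [redIn_univ_eq]
    ext a
    exact ⟨fun ⟨b, hb⟩ => hb ▸ (e b).2, fun ha => ⟨e.symm ⟨a, ha⟩, by simp⟩⟩
  · have h1 : e 0 ≤ ⟨s, .inl hsr⟩ := by
      rw [← e.le_symm_apply]; exact Fin.zero_le _
    exact le_trans (show (e 0 : L) ≤ s from h1) (hs x)
  · have h1 : ⟨t, .inr htr⟩ ≤ e 3 := by
      rw [← e.symm_apply_le]; exact Fin.le_last _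
    exact le_trans (ht x) (show t ≤ (e 3 : L) from h1)

end Lattice

section Nullity

variable {P : Type*} [PartialOrder P]

theorem ncard_edgeSet_hasse [Fintype P] :
    (SimpleGraph.hasse P).edgeSet.ncard = ∑ x : P, {y | x ⋖ y}.ncard := by
  have himg : (SimpleGraph.hasse P).edgeSet = (fun p : P × P => s(p.1, p.2)) ''
      {p | p.1 ⋖ p.2} := by
    ext e
    induction e with
    | _ x y =>
      rw [SimpleGraph.mem_edgeSet, SimpleGraph.hasse_adj]
      constructor
      · rintro (h | h)
        · exact ⟨(x, y), h, rfl⟩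
        · exact ⟨(y, x), h, Sym2.eq_swap⟩
      · rintro ⟨⟨u, v⟩, huv, h⟩
        rcases Sym2.eq_iff.1 h with ⟨rfl, rfl⟩ | ⟨rfl, rfl⟩
        · exact .inl huv
        · exact .inr huv
  have hinj : Set.InjOn (fun p : P × P => s(p.1, p.2)) {p | p.1 ⋖ p.2} := by
    rintro ⟨a, b⟩ hab ⟨c, d⟩ hcd h
    rcases Sym2.eq_iff.1 h with ⟨h1, h2⟩ | ⟨h1, h2⟩
    · exact Prod.ext h1 h2
    · simp only at h1 h2
      subst h1 h2
      exact absurd hab.1 (lt_asymm hcd.1)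
  rw [himg, hinj.ncard_image, ← Nat.card_coe_set_eq]
  exact (Nat.card_congr (Equiv.subtypeProdEquivSigmaSubtype fun x y : P => x ⋖ y)).trans
    Nat.card_sigma

theorem card_connectedComponent_hasse [Finite P] {s : P} (hs : IsBot s) :
    Nat.card (SimpleGraph.hasse P).ConnectedComponent = 1 := by
  have hreach : ∀ x : P, (SimpleGraph.hasse P).Reachable s x := by
    intro x
    induction x using (wellFounded_lt (α := P)).induction with
    | _ x ih =>
      rcases (hs x).eq_or_lt with rfl | hlt
      · exact .refl _
      · obtain ⟨y, -, hy⟩ := exists_le_covBy_of_lt hlt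
        exact (ih y hy.1).trans (SimpleGraph.Adj.reachable (SimpleGraph.hasse_adj.2 (.inl hy)))
  have hpre : (SimpleGraph.hasse P).Preconnected := fun x y => (hreach x).symm.trans (hreach y)
  rw [Nat.card_eq_one_iff_unique]
  exact ⟨hpre.subsingleton_connectedComponent, ⟨SimpleGraph.connectedComponentMk _ s⟩⟩

theorem IsRedChain.nullity_add_eq [Finite P] {r : Fin 4 → P} (h : IsRedChain Set.univ r) :
    nullity P + 3 = ∑ a, ∑ b, ((edgesIn Set.univ (r a) (r b)).ncard : ℤ) := by
  have := Fintype.ofFinite P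
  have h1 : ∀ x : P, x ∉ Set.range r → (({y | x ⋖ y}.ncard : ℤ) - 1) = 0 := by
    intro x hx
    rw [h.range_eq] at hx
    obtain ⟨v, hv⟩ := h.exists_covIn_right (Set.mem_univ x) hx
    have : {y | x ⋖ y} = {v} := by
      ext y
      rw [Set.mem_singleton_iff]
      refine ⟨fun hy => upper_unique_of_notMem_redIn hx (covIn_univ_iff.2 hy) hv, ?_⟩
      rintro rfl
      exact covIn_univ_iff.1 hv
    rw [this, Set.ncard_singleton]; rfl
  have h2 := Fintype.sum_of_injective r h.mono.injective
    (fun a => (({y | r a ⋖ y}.ncard : ℤ) - 1)) _ h1 fun _ => rfl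
  have h3 : ∀ a, ({y | r a ⋖ y}.ncard : ℤ) = ∑ b, ((edgesIn Set.univ (r a) (r b)).ncard : ℤ) := by
    intro a
    have := h.ncard_upper_eq a
    simp only [covIn_univ_iff] at this
    exact_mod_cast this
  rw [nullity, ncard_edgeSet_hasse,
    card_connectedComponent_hasse (s := r 0) fun x => h.bot_le x (Set.mem_univ x),
    Nat.card_eq_fintype_card]
  simp only [Finset.sum_sub_distrib, h3] at h2
  simp only [Finset.sum_const, Finset.card_univ, Fintype.card_fin, nsmul_eq_mul, mul_one] at h2
  push_cast at h2 ⊢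
  linarith

end Nullity

theorem redIn_univ_orderIso {P P' : Type*} [PartialOrder P] [PartialOrder P'] (e : P ≃o P')
    (x : P) :
    e x ∈ redIn (Set.univ : Set P') ↔ x ∈ redIn (Set.univ : Set P) := by
  have hd : {u | u ⋖ e x} = e '' {u | u ⋖ x} := by
    ext u
    rw [e.image_eq_preimage_symm]
    simp only [Set.mem_preimage, Set.mem_ofPred_eq]
    rw [← apply_covBy_apply_iff e, e.apply_symm_apply]
  have hu : {u | e x ⋖ u} = e '' {u | x ⋖ u} := by
    ext u
    rw [e.image_eq_preimage_symm]
    simp only [Set.mem_preimage, Set.mem_ofPred_eq]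
    rw [← apply_covBy_apply_iff e, e.apply_symm_apply]
  simp only [redIn, covIn_univ_iff, Set.mem_ofPred_eq, Set.mem_univ, true_and, hd, hu,
    e.injective.subsingleton_image_iff]

theorem ncard_edgesIn_univ_orderIso {P P' : Type*} [PartialOrder P] [PartialOrder P'] (e : P ≃o P')
    (r s : P) : (edgesIn Set.univ (e r) (e s)).ncard = (edgesIn Set.univ r s).ncard := by
  rw [← Set.ncard_image_of_injective _ e.injective]
  congr 1
  ext v
  obtain ⟨v, rfl⟩ := e.surjective v
  rw [e.injective.mem_set_image]
  simp only [edgesIn, Set.mem_ofPred_eq, covIn_univ_iff, apply_covBy_apply_iff, IsLeast,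
    lowerBounds, redIn_univ_orderIso, e.le_iff_le, e.surjective.forall]

theorem IsRedChain.map_orderIso {P P' : Type*} [PartialOrder P] [PartialOrder P'] {r : Fin 4 → P}
    (h : IsRedChain Set.univ r) (e : P ≃o P') : IsRedChain Set.univ (e ∘ r) := by
  refine ⟨e.strictMono.comp h.mono, ?_, fun x _ => ?_, fun x _ => ?_⟩
  · ext x
    obtain ⟨x, rfl⟩ := e.surjective x
    rw [redIn_univ_orderIso, ← h.range_eq, Set.range_comp, e.injective.mem_set_image]
  · obtain ⟨x, rfl⟩ := e.surjective x
    exact e.monotone (h.bot_le x trivial)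
  · obtain ⟨x, rfl⟩ := e.surjective x
    exact e.monotone (h.le_top x trivial)

/-! ### The twenty-two basic blocks -/

namespace AdjunctData

/-- The underlying set of an adjunct as a disjoint sum. -/
def Elem.equivSum (D : AdjunctData) : D.Elem ≃ Fin D.len ⊕ Fin 3 where
  toFun
    | .chain x => .inl x
    | .extra i => .inr i
  invFun
    | .inl x => .chain x
    | .inr i => .extra i
  left_inv x := by cases x <;> rfl
  right_inv x := by cases x <;> rfl

instance (D : AdjunctData) : Fintype D.Elem := Fintype.ofEquiv _ (Elem.equivSum D).symm

instance (D : AdjunctData) : DecidableEq D.Elem := (Elem.equivSum D).decidableEq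

instance (D : AdjunctData) : DecidableLE D.Elem
  | .chain x, .chain y => inferInstanceAs (Decidable (x ≤ y))
  | .chain x, .extra i => inferInstanceAs (Decidable (x ≤ D.lo i))
  | .extra i, .chain y => inferInstanceAs (Decidable (D.hi i ≤ y))
  | .extra i, .extra k => inferInstanceAs (Decidable (i = k ∨ D.hi i ≤ D.lo k))

/-- A rank function on an adjunct. -/
def Elem.rank {D : AdjunctData} : D.Elem → ℕ
  | .chain x => x
  | .extra i => D.lo i + 1

theorem Elem.rank_lt {D : AdjunctData} (x : D.Elem) : x.rank < D.len := by
  cases x with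
  | chain x => exact x.2
  | extra i => exact (D.gap i).trans (D.hi i).2

theorem Elem.rank_strictMono (D : AdjunctData) : StrictMono (Elem.rank (D := D)) := by
  intro x y hxy
  have h := D.gap
  obtain ⟨h1, h2⟩ := lt_iff_le_not_ge.1 hxy
  change Elem.le _ _ at h1
  change ¬ Elem.le _ _ at h2
  cases x <;> cases y <;> simp only [Elem.le, Elem.rank, Fin.le_def] at * <;> grind

theorem krullDim_elem (D : AdjunctData) (h : 0 < D.len) :
    Order.krullDim D.Elem = ((D.len - 1 : ℕ) : WithBot ℕ∞) := by
  apply le_antisymm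
  · refine iSup_le fun l => ?_
    have hmono : StrictMono fun x : D.Elem => (⟨x.rank, x.rank_lt⟩ : Fin D.len) :=
      fun x y hxy => Elem.rank_strictMono D hxy
    have := (l.map _ hmono).length_lt_card
    rw [Fintype.card_fin] at this
    have h2 : l.length ≤ D.len - 1 := by
      change l.length < D.len at this
      omega
    exact_mod_cast h2
  · rw [Order.le_krullDim_iff]
    refine ⟨LTSeries.mk (D.len - 1) (fun a => .chain ⟨a, by omega⟩) ?_, rfl⟩
    intro a b hab
    have hab : (a : ℕ) < b := hab
    refine lt_iff_le_not_ge.2 ⟨?_, fun h => ?_⟩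
    · exact Fin.le_def.2 hab.le
    · exact hab.not_ge (Fin.le_def.1 h)

/-- The lower end of an element: itself in the chain, and the lower element of the adjunct pair. -/
def Elem.loPos {D : AdjunctData} : D.Elem → ℕ
  | .chain x => x
  | .extra i => D.lo i

/-- The upper end of an element: itself in the chain, and the upper element of the adjunct pair. -/
def Elem.hiPos {D : AdjunctData} : D.Elem → ℕ
  | .chain x => x
  | .extra i => D.hi i

end AdjunctData

/-- The positions of the reducible elements in the chains of the basic blocks. -/
def redPos : Fin 22 → Fin 4 → ℕ :=
  ![![0, 1, 2, 3], ![0, 1, 2, 3], ![0, 1, 2, 3], ![0, 1, 3, 4], ![0, 1, 3, 4], ![0, 1, 2, 4],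
    ![0, 2, 3, 4], ![0, 1, 2, 4], ![0, 2, 3, 4], ![0, 1, 3, 4], ![0, 1, 3, 4], ![0, 1, 3, 4],
    ![0, 2, 3, 5], ![0, 2, 3, 5], ![0, 2, 4, 5], ![0, 1, 3, 5], ![0, 2, 3, 5], ![0, 2, 3, 5],
    ![0, 2, 4, 5], ![0, 1, 3, 5], ![0, 2, 3, 5], ![0, 2, 4, 6]]

theorem redPos_lt : ∀ i a, redPos i a < (basicBlock i).len := by decide +kernel

/-- The reducible elements of the basic blocks. -/
def redElem (i : Fin 22) (a : Fin 4) : (basicBlock i).Elem := .chain ⟨redPos i a, redPos_lt i a⟩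

/-- The largest reducible element below an element of a basic block. -/
def loRed (i : Fin 22) (x : (basicBlock i).Elem) : Fin 4 :=
  if redPos i 3 ≤ x.loPos then 3 else if redPos i 2 ≤ x.loPos then 2
    else if redPos i 1 ≤ x.loPos then 1 else 0

/-- The smallest reducible element above an element of a basic block. -/
def hiRed (i : Fin 22) (x : (basicBlock i).Elem) : Fin 4 :=
  if x.hiPos ≤ redPos i 0 then 0 else if x.hiPos ≤ redPos i 1 then 1
    else if x.hiPos ≤ redPos i 2 then 2 else 3

/-- The number of irreducible elements of a basic block between two reducible elements. -/
def outerCount (i : Fin 22) (a b : Fin 4) : ℕ :=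
  (Finset.univ.filter fun x => (∀ c, redElem i c ≠ x) ∧ loRed i x = a ∧ hiRed i x = b).card

theorem isFrame_redElem (i : Fin 22) : IsFrame (redElem i) (loRed i) (hiRed i) := by
  have h1 : ∀ i a b, redElem i a ≤ redElem i b ↔ a ≤ b := by decide +kernel
  have h2 : ∀ i a x, (∀ c, redElem i c ≠ x) → (redElem i a ≤ x ↔ a ≤ loRed i x) := by
    decide +kernel
  have h3 : ∀ i a x, (∀ c, redElem i c ≠ x) → (x ≤ redElem i a ↔ hiRed i x ≤ a) := by
    decide +kernel
  have h4 : ∀ i x y, (∀ c, redElem i c ≠ x) → (∀ c, redElem i c ≠ y) →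
      (x ≤ y ↔ x = y ∨ hiRed i x ≤ loRed i y) := by
    decide +kernel
  have hr : ∀ x, x ∉ Set.range (redElem i) → ∀ c, redElem i c ≠ x := fun x hx c hc => hx ⟨c, hc⟩
  exact ⟨h1 i, fun a x hx => h2 i a x (hr x hx), fun a x hx => h3 i a x (hr x hx),
    fun x y hx hy => h4 i x y (hr x hx) (hr y hy)⟩

theorem ncard_outer_eq_outerCount (i : Fin 22) (a b : Fin 4) :
    {x | x ∉ Set.range (redElem i) ∧ loRed i x = a ∧ hiRed i x = b}.ncard = outerCount i a b := by
  rw [outerCount, ← Set.ncard_coe_finset]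
  congr 1
  ext x
  simp

/-- A numerical invariant of finite posets that distinguishes the basic blocks. -/
noncomputable def coneWeight (P : Type*) [PartialOrder P] [Fintype P] : ℕ :=
  ∑ x : P, {y | y ≤ x}.ncard * {y | x ≤ y}.ncard ^ 2

theorem coneWeight_congr {P P' : Type*} [PartialOrder P] [PartialOrder P'] [Fintype P] [Fintype P']
    (e : P ≃o P') : coneWeight P = coneWeight P' := by
  refine Fintype.sum_equiv e.toEquiv _ _ fun x => ?_
  have hd : {y | y ≤ e x} = e '' {y | y ≤ x} := by
    ext y
    obtain ⟨y, rfl⟩ := e.surjective y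
    simp
  have hu : {y | e x ≤ y} = e '' {y | x ≤ y} := by
    ext y
    obtain ⟨y, rfl⟩ := e.surjective y
    simp
  simp only [RelIso.coe_fn_toEquiv, hd, hu, Set.ncard_image_of_injective _ e.injective]

theorem eq_of_orderIso_basicBlock {i k : Fin 22} (e : (basicBlock i).Elem ≃o (basicBlock k).Elem) :
    i = k := by
  have hw : ∀ i, coneWeight (basicBlock i).Elem = ∑ x : (basicBlock i).Elem,
      (Finset.univ.filter (· ≤ x)).card * (Finset.univ.filter (x ≤ ·)).card ^ 2 := by
    intro i
    refine Finset.sum_congr rfl fun x _ => ?_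
    rw [← Set.ncard_coe_finset, ← Set.ncard_coe_finset]
    simp
  have hinj : ∀ i k : Fin 22, (∑ x : (basicBlock i).Elem,
      (Finset.univ.filter (· ≤ x)).card * (Finset.univ.filter (x ≤ ·)).card ^ 2) =
      (∑ x : (basicBlock k).Elem,
      (Finset.univ.filter (· ≤ x)).card * (Finset.univ.filter (x ≤ ·)).card ^ 2) → i = k := by
    decide +kernel
  exact hinj i k (by rw [← hw, ← hw, coneWeight_congr e])

/-- The number of irreducible elements on the edges of a basic retract, in terms of the number of
edges. -/
def midCount (m : Fin 4 → Fin 4 → ℕ) (a b : Fin 4) : ℕ :=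
  if (a : ℕ) + 1 = b ∧ m a b = 1 then 0 else m a b

/-- The six multiplicities of the edges of a multigraph on four vertices. -/
def edgeMatrix (e₀₁ e₁₂ e₂₃ e₀₂ e₁₃ e₀₃ : ℕ) : Fin 4 → Fin 4 → ℕ :=
  ![![0, e₀₁ + 1, e₀₂, e₀₃], ![0, 0, e₁₂ + 1, e₁₃], ![0, 0, 0, e₂₃ + 1], ![0, 0, 0, 0]]

theorem exists_outerCount_eq_midCount (m : Fin 4 → Fin 4 → ℕ) (hzero : ∀ a b, b ≤ a → m a b = 0)
    (hpos : ∀ a b : Fin 4, (a : ℕ) + 1 = b → 0 < m a b) (hsum : ∑ a, ∑ b, m a b = 6)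
    (hred : ∀ c, 2 ≤ ∑ b, m c b ∨ 2 ≤ ∑ a, m a c) :
    ∃ i, ∀ a b, outerCount i a b = midCount m a b := by
  have key : ∀ e₀₁ e₁₂ e₂₃ e₀₂ e₁₃ e₀₃ : Fin 4,
      (e₀₁ + e₁₂ + e₂₃ + e₀₂ + e₁₃ + e₀₃ : ℕ) = 3 ∧ (1 ≤ (e₀₁ + e₀₂ + e₀₃ : ℕ) ∧
        1 ≤ (e₂₃ + e₁₃ + e₀₃ : ℕ) ∧ 1 ≤ (e₀₁ + e₁₂ + e₁₃ : ℕ) ∧ 1 ≤ (e₁₂ + e₂₃ + e₀₂ : ℕ)) →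
      ∃ i, ∀ a b, outerCount i a b = midCount (edgeMatrix e₀₁ e₁₂ e₂₃ e₀₂ e₁₃ e₀₃) a b := by
    decide +kernel
  obtain ⟨e₀₁, h01⟩ := Nat.exists_eq_add_of_lt (hpos 0 1 rfl)
  obtain ⟨e₁₂, h12⟩ := Nat.exists_eq_add_of_lt (hpos 1 2 rfl)
  obtain ⟨e₂₃, h23⟩ := Nat.exists_eq_add_of_lt (hpos 2 3 rfl)
  rw [zero_add] at h01 h12 h23
  have hm : m = edgeMatrix e₀₁ e₁₂ e₂₃ (m 0 2) (m 1 3) (m 0 3) := by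
    funext a b
    fin_cases a <;> fin_cases b <;>
      first | exact hzero _ _ (by decide) | rfl | exact h01 | exact h12 | exact h23
  have z := fun a b h => hzero a b h
  have r0 := hred 0
  have r1 := hred 1
  have r2 := hred 2
  have r3 := hred 3
  simp only [Fin.sum_univ_four, h01, h12, h23, z 0 0 le_rfl, z 1 1 le_rfl, z 2 2 le_rfl,
    z 3 3 le_rfl, z 1 0 (by decide), z 2 0 (by decide), z 3 0 (by decide), z 2 1 (by decide),
    z 3 1 (by decide), z 3 2 (by decide)] at hsum r0 r1 r2 r3
  rw [hm]
  exact key ⟨e₀₁, by omega⟩ ⟨e₁₂, by omega⟩ ⟨e₂₃, by omega⟩ ⟨m 0 2, by omega⟩ ⟨m 1 3, by omega⟩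
    ⟨m 0 3, by omega⟩ (by simp only; omega)

/-! ### The associated basic blocks -/

section Associated

variable {P : Type*} [PartialOrder P] [Finite P] {r : Fin 4 → P}

theorem IsRedChain.isAssociatedBasicBlock_iff (h : IsRedChain Set.univ r) {S : Set P} :
    IsAssociatedBasicBlock S ↔ IsAssociatedBasicRetract S := by
  constructor
  · rintro ⟨R, hR, hRS, -⟩
    rcases hRS.cases_head with rfl | ⟨T, ⟨x, hx, -⟩, -⟩
    · exact hR
    · exact absurd hx ((h.of_retract hR.1).not_isPendant x)
  · intro hS
    exact ⟨S, hS, .refl, (h.of_retract hS.1).not_isPendant⟩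

theorem IsRedChain.exists_isFrame_of_isAssociatedBasicBlock (h : IsRedChain Set.univ r) {S : Set P}
    (hS : IsAssociatedBasicBlock S) :
    ∃ (r' : Fin 4 → S) (lo hi : S → Fin 4), IsFrame r' lo hi ∧
      ∀ a b, {x | x ∉ Set.range r' ∧ lo x = a ∧ hi x = b}.ncard =
        midCount (fun a b => (edgesIn Set.univ (r a) (r b)).ncard) a b := by
  rw [h.isAssociatedBasicBlock_iff] at hS
  have hc := h.of_retract hS.1
  obtain ⟨r', lo, hi, hf, hn⟩ := hc.exists_isFrame hS.2
  refine ⟨r', lo, hi, hf, fun a b => ?_⟩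
  rw [hn, hc.ncard_midIn hS.2, ncard_edgesIn_eq_of_retract hS.1 (h.mem_redIn a), midCount]

end Associated

theorem basicBlock_len_mem : ∀ i, 4 ≤ (basicBlock i).len ∧ (basicBlock i).len ≤ 7 := by
  decide +kernel

theorem krullDim_basicBlock (i : Fin 22) :
    Order.krullDim (basicBlock i).Elem = (((basicBlock i).len - 1 : ℕ) : WithBot ℕ∞) :=
  (basicBlock i).krullDim_elem (by have := (basicBlock_len_mem i).1; omega)

namespace IsBlockWith

variable {L L' : Type*} [Lattice L] [Finite L] [Lattice L'] [Finite L']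

theorem exists_isRedChain (h : IsBlockWith L 4 3) : ∃ r : Fin 4 → L, IsRedChain Set.univ r :=
  _root_.exists_isRedChain h.1 h.2.1 h.2.2.1

theorem exists_isAssociatedBasicBlock (h : IsBlockWith L 4 3) :
    ∃ S : Set L, IsAssociatedBasicBlock S := by
  obtain ⟨r, hr⟩ := h.exists_isRedChain
  obtain ⟨S, hS⟩ := exists_isAssociatedBasicRetract L
  exact ⟨S, hr.isAssociatedBasicBlock_iff.2 hS⟩

theorem exists_orderIso_basicBlock (h : IsBlockWith L 4 3) {S : Set L}
    (hS : IsAssociatedBasicBlock S) : ∃ i, Nonempty (S ≃o (basicBlock i).Elem) := by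
  obtain ⟨r, hr⟩ := h.exists_isRedChain
  obtain ⟨r', lo, hi, hf, hn⟩ := hr.exists_isFrame_of_isAssociatedBasicBlock hS
  have hR := hr.isAssociatedBasicBlock_iff.1 hS
  have hsum := hr.nullity_add_eq
  rw [h.2.2.2] at hsum
  obtain ⟨i, hi⟩ := exists_outerCount_eq_midCount
    (fun a b => (edgesIn Set.univ (r a) (r b)).ncard)
    (fun a b hab => hr.ncard_edgesIn_eq_zero hab) (fun a b hab => hr.ncard_edgesIn_pos hab)
    (by exact_mod_cast hsum.symm) fun c => by
      simpa only [ncard_edgesIn_eq_of_retract hR.1 (hr.mem_redIn _)] using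
        (hr.of_retract hR.1).two_le_of_basic hR.2 c
  exact ⟨i, hf.nonempty_orderIso (isFrame_redElem i) fun a b => by
    rw [hn, ncard_outer_eq_outerCount, hi]⟩

theorem nonempty_orderIso_of_isAssociatedBasicBlock (h : IsBlockWith L 4 3) (e : L ≃o L')
    {S : Set L} {S' : Set L'} (hS : IsAssociatedBasicBlock S) (hS' : IsAssociatedBasicBlock S') :
    Nonempty (S ≃o S') := by
  obtain ⟨r, hr⟩ := h.exists_isRedChain
  obtain ⟨_, _, _, hf, hn⟩ := hr.exists_isFrame_of_isAssociatedBasicBlock hS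
  obtain ⟨_, _, _, hf', hn'⟩ := (hr.map_orderIso e).exists_isFrame_of_isAssociatedBasicBlock hS'
  refine hf.nonempty_orderIso hf' fun a b => ?_
  rw [hn, hn']
  simp only [Function.comp_apply, ncard_edgesIn_univ_orderIso]

theorem eq_of_basicBlockHasType (h : IsBlockWith L 4 3) (e : L ≃o L') {i k : Fin 22}
    (hi : BasicBlockHasType L (basicBlock i).Elem) (hk : BasicBlockHasType L' (basicBlock k).Elem) :
    i = k := by
  obtain ⟨S, hS, ⟨f⟩⟩ := hi
  obtain ⟨S', hS', ⟨f'⟩⟩ := hk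
  obtain ⟨g⟩ := h.nonempty_orderIso_of_isAssociatedBasicBlock e hS hS'
  exact eq_of_orderIso_basicBlock (f.symm.trans (g.trans f'))

theorem basicBlockHasHeight_iff (h : IsBlockWith L 4 3) (n : ℕ) :
    BasicBlockHasHeight L n ↔
      ∃ i, (basicBlock i).len - 1 = n ∧ BasicBlockHasType L (basicBlock i).Elem := by
  constructor
  · rintro ⟨S, hS, hd⟩
    obtain ⟨i, ⟨e⟩⟩ := h.exists_orderIso_basicBlock hS
    rw [Order.krullDim_eq_of_orderIso e, krullDim_basicBlock] at hd
    exact ⟨i, by exact_mod_cast hd, S, hS, ⟨e⟩⟩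
  · rintro ⟨i, rfl, S, hS, ⟨e⟩⟩
    exact ⟨S, hS, by rw [Order.krullDim_eq_of_orderIso e, krullDim_basicBlock]⟩

end IsBlockWith

/-! ### Counting -/

theorem blockClasses_eq_iUnion (j : ℕ) :
    blockClasses j 4 3 = ⋃ i, blockClassesOfType j 4 3 (basicBlock i).Elem := by
  ext c
  rw [Set.mem_iUnion]
  constructor
  · rintro ⟨A, rfl, hA⟩
    obtain ⟨S, hS⟩ := hA.exists_isAssociatedBasicBlock
    obtain ⟨i, hi⟩ := hA.exists_orderIso_basicBlock hS
    exact ⟨i, A, rfl, hA, S, hS, hi⟩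
  · rintro ⟨i, A, rfl, hA, -⟩
    exact ⟨A, rfl, hA⟩

theorem pairwise_disjoint_blockClassesOfType (j : ℕ) :
    Pairwise (Function.onFun Disjoint
      fun i => blockClassesOfType j 4 3 (basicBlock i).Elem) := by
  intro i k hik
  rw [Function.onFun, Set.disjoint_left]
  rintro c ⟨A, rfl, hA, hi⟩ ⟨A', hAA', -, hk⟩
  obtain ⟨f⟩ := Quotient.exact hAA'.symm
  exact hik (@IsBlockWith.eq_of_basicBlockHasType (Fin j) (Fin j) A _ A' _ hA f _ _ hi hk)

theorem blockClassesOfHeight_eq_biUnion (j h : ℕ) :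
    blockClassesOfHeight j 4 3 h =
      ⋃ i ∈ {i | (basicBlock i).len - 1 = h}, blockClassesOfType j 4 3 (basicBlock i).Elem := by
  ext c
  simp only [Set.mem_iUnion]
  constructor
  · rintro ⟨A, rfl, hA, hh⟩
    obtain ⟨i, hi, ht⟩ := (hA.basicBlockHasHeight_iff h).1 hh
    exact ⟨i, hi, A, rfl, hA, ht⟩
  · rintro ⟨i, hi, A, rfl, hA, ht⟩
    exact ⟨A, rfl, hA, (hA.basicBlockHasHeight_iff h).2 ⟨i, hi, ht⟩⟩

theorem sum_ncard_blockClassesOfHeight (j : ℕ) :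
    ∑ h ∈ Finset.Icc 3 6, (blockClassesOfHeight j 4 3 h).ncard
      = ∑ i : Fin 22, (blockClassesOfType j 4 3 (basicBlock i).Elem).ncard := by
  rw [← Finset.sum_fiberwise_of_maps_to (s := Finset.univ) (t := Finset.Icc 3 6)
    (g := fun i : Fin 22 => (basicBlock i).len - 1)
    (fun i _ => by have := basicBlock_len_mem i; rw [Finset.mem_Icc]; omega)]
  refine Finset.sum_congr rfl fun h _ => ?_
  rw [blockClassesOfHeight_eq_biUnion, (Set.toFinite _).ncard_biUnion (fun _ _ => Set.toFinite _)
    fun i _ k _ hik => pairwise_disjoint_blockClassesOfType j hik,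
    finsum_mem_eq_finite_toFinset_sum _ (Set.toFinite _)]
  congr 1
  ext i
  simp

theorem ncard_blockClasses (j : ℕ) :
    (blockClasses j 4 3).ncard
      = ∑ i : Fin 22, (blockClassesOfType j 4 3 (basicBlock i).Elem).ncard := by
  rw [blockClasses_eq_iUnion, Set.ncard_iUnion_of_finite (fun _ => Set.toFinite _)
    (pairwise_disjoint_blockClassesOfType j), finsum_eq_sum_of_fintype]

theorem mainTheorem2 (j : ℕ) (hj : 7 ≤ j) :
    (blockClasses j 4 3).ncard
        = ∑ h ∈ Finset.Icc 3 6, (blockClassesOfHeight j 4 3 h).ncard ∧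
      ∑ h ∈ Finset.Icc 3 6, (blockClassesOfHeight j 4 3 h).ncard
        = ∑ i : Fin 22, (blockClassesOfType j 4 3 (basicBlock i).Elem).ncard :=
  ⟨(ncard_blockClasses j).trans (sum_ncard_blockClassesOfHeight j).symm,
    sum_ncard_blockClassesOfHeight j⟩
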